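/- Let $L=\{(x_1,x_2)\in\mathbb R^2 : x_1^2+4x_2^2=4\}$ be the ellipse parametrized by $(2\cos\theta,\sin\theta)$, $0\le\theta\le 2\pi$, and let $P$ be the uniform distribution on $L$, i.e. arc length on $L$ divided by the total length of $L$: $$dP=\frac1A\sqrt{4\sin^2\theta+\cos^2\theta}\,d\theta,\qquad A=\int_0^{2\pi}\sqrt{4\sin^2\theta+\cos^2\theta}\,d\theta .$$ For $n\in\mathbb N$ let $$V_n=\inf\Big\{\int\min_{a\in\alpha}\|x-a\|^2\,dP(x) : \alpha\subset\mathbb R^2,\ \alpha\neq\emptyset,\ \operatorname{card}(\alpha)\le n\Big\},$$ and call a nonempty set $\alpha$ with at most $n$ points for which the infimum is attained an optimal set of $n$-means for $P$. Then there is a real number $a$, equal to $1.13964$ when rounded to five decimals ($|a-1.13964|<5\cdot10^{-6}$), such that $\{(a,0),(-a,0)\}$ is an optimal set of two-means for $P$ and is the only one. The quantization error $V_2$ equals $0.961441$ when rounded to six decimals ($|V_2-0.961441|<5\cdot10^{-7}$). -/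

import Mathlib

open MeasureTheory Set
open scoped ENNReal

noncomputable section

/-- The Euclidean plane. -/
abbrev Plane : Type := EuclideanSpace ℝ (Fin 2)

/-- The distortion `∫ min_{a ∈ α} ‖x - a‖² dP(x)` of a set `α` for `P`, as an extended nonnegative
real. For finite nonempty `α` the infimum over `α` is a minimum; for `α = ∅` it is `∞`. -/
def distortion {E : Type*} [NormedAddCommGroup E] [MeasurableSpace E]
    (P : Measure E) (α : Set E) : ℝ≥0∞ :=
  ∫⁻ x, ⨅ a ∈ α, ENNReal.ofReal (‖x - a‖ ^ 2) ∂P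

/-- The `n`-th quantization error `V_n(P)`: the infimum of the distortion over all sets of at most
`n` points. -/
def quantizationError {E : Type*} [NormedAddCommGroup E] [MeasurableSpace E]
    (n : ℕ) (P : Measure E) : ℝ≥0∞ :=
  ⨅ (α : Set E) (_ : α.encard ≤ n), distortion P α

/-- `α` is an optimal set of `n`-means for `P`: it has at most `n` points and attains `V_n(P)`. -/
def IsOptimalSetOfMeans {E : Type*} [NormedAddCommGroup E] [MeasurableSpace E]
    (n : ℕ) (P : Measure E) (α : Set E) : Prop :=
  α.encard ≤ n ∧ distortion P α = quantizationError n P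

/-- The arc length measure `ds = ‖γ'(θ)‖ dθ` of a (differentiable) parametrised plane curve
`γ : [s, t] → ℝ²`, as a measure on the plane. -/
def arcLengthMeasure (γ : ℝ → Plane) (s t : ℝ) : Measure Plane :=
  ((volume.restrict (Icc s t)).withDensity fun θ => ‖deriv γ θ‖ₑ).map γ

/-- The uniform distribution on a parametrised curve: arc length divided by the total length. -/
def uniformOnCurve (γ : ℝ → Plane) (s t : ℝ) : Measure Plane :=
  (arcLengthMeasure γ s t univ)⁻¹ • arcLengthMeasure γ s t

/-- The parametrisation `θ ↦ (2 cos θ, sin θ)` of the ellipse `x₁² + 4 x₂² = 4`. -/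
def ellipseParam (θ : ℝ) : Plane := !₂[2 * Real.cos θ, Real.sin θ]

/-- The uniform distribution on the elliptical curve `x₁² + 4 x₂² = 4`. -/
def ellipseUniform : Measure Plane := uniformOnCurve ellipseParam 0 (2 * Real.pi)

/-- The parametrisation covers exactly the curve `x₁² + 4 x₂² = 4`. -/
theorem ellipseParam_image :
    ellipseParam '' Icc 0 (2 * Real.pi) = {x : Plane | x 0 ^ 2 + 4 * x 1 ^ 2 = 4} := by
  ext x
  simp only [mem_image, mem_ofPred_eq]
  constructor
  · rintro ⟨θ, -, rfl⟩
    simp only [ellipseParam, PiLp.toLp_apply, Matrix.cons_val_zero, Matrix.cons_val_one]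
    nlinarith [Real.sin_sq_add_cos_sq θ]
  · intro h
    have hz : ‖(⟨x 0 / 2, x 1⟩ : ℂ)‖ = 1 := by
      rw [Complex.norm_def, Complex.normSq_mk, Real.sqrt_eq_one]
      linarith
    have hc := Complex.norm_mul_cos_arg (⟨x 0 / 2, x 1⟩ : ℂ)
    have hs := Complex.norm_mul_sin_arg (⟨x 0 / 2, x 1⟩ : ℂ)
    set φ := Complex.arg (⟨x 0 / 2, x 1⟩ : ℂ) with hφ
    rw [hz, one_mul] at hc hs
    have key : ∃ θ ∈ Icc 0 (2 * Real.pi), Real.cos θ = x 0 / 2 ∧ Real.sin θ = x 1 := by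
      refine ⟨toIcoMod Real.two_pi_pos 0 φ, ?_, ?_, ?_⟩
      · have := toIcoMod_mem_Ico Real.two_pi_pos 0 φ
        rw [zero_add] at this
        exact ⟨this.1, this.2.le⟩
      · rw [toIcoMod, Real.cos_periodic.sub_zsmul_eq, hc]
      · rw [toIcoMod, Real.sin_periodic.sub_zsmul_eq, hs]
    obtain ⟨θ, hθ, h0, h1⟩ := key
    refine ⟨θ, hθ, ?_⟩
    ext i
    fin_cases i
    · simp [ellipseParam, h0]; ring
    · simp [ellipseParam, h1]

/-- Every point of the curve, except for the coincidence of the two endpoints, is covered once. -/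
theorem ellipseParam_injOn : InjOn ellipseParam (Ico 0 (2 * Real.pi)) := by
  intro s hs t ht h
  have h0 : Real.cos s = Real.cos t := by
    have := congrArg (fun x : Plane => x 0) h
    simpa [ellipseParam] using this
  have h1 : Real.sin s = Real.sin t := by
    have := congrArg (fun x : Plane => x 1) h
    simpa [ellipseParam] using this
  have := (Real.Angle.cos_sin_inj h0 h1)
  obtain ⟨k, hk⟩ := Real.Angle.angle_eq_iff_two_pi_dvd_sub.1 this
  have hp := Real.pi_pos
  have k1 : (k : ℝ) < 1 := by
    by_contra hc
    nlinarith [hs.1, hs.2, ht.1, ht.2, not_lt.1 hc]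
  have k2 : (-1 : ℝ) < k := by
    by_contra hc
    nlinarith [hs.1, hs.2, ht.1, ht.2, not_lt.1 hc]
  have : k = 0 := by
    have a1 : k < 1 := by exact_mod_cast k1
    have a2 : -1 < k := by exact_mod_cast k2
    omega
  subst this
  simp at hk
  linarith

end

/-!
For a centred measure, write two candidate centres as `m + d` and `m - d`. The minimum of the two
squared distances is `‖x - m‖² + ‖d‖² - 2 |⟪d, x⟫ - ⟪d, m⟫|`, so `{v, -v}` is the only optimal pair
as soon as `𝔼 |⟪v, x⟫| = ‖v‖²` and `(𝔼 |⟪d, x⟫ - c|)² < ‖v‖² ‖d‖² + c²` for `d ≠ 0`, unless `c = 0`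
and `d` is a multiple of `v`.

For the ellipse, `v = (a, 0)` with `a = 𝔼 |x₀|`. When `d` is closer to the minor axis, the second
moments and the Cauchy–Schwarz inequality suffice. Otherwise normalise `d` to `(1, t)` with
`|t| ≤ 1`. If `c` is so large that `x₀ + t x₁ - c` has constant sign, the bound is immediate.
If not, the reflections in the axes and convexity bound `𝔼 |x₀ + t x₁ - c|` by expectations
`𝔼 max(|x₀|, k)`. These are at most `a + k² / 4`: on a quarter of the ellipse the arc length density
and the multiple of `sin` of the same mass cross only once, and the estimate for the latter is
explicit.

The speed of the parametrisation is `3 / 2 * ‖1 - z / 3‖` with `z = exp (2 i θ)`. As the squared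
modulus of `√(1 - z / 3)`, it has mean and first Fourier coefficient given by Parseval's identity in
terms of the Taylor coefficients of the square root; `a` reduces to `arsinh √3` and the perimeter.
-/

noncomputable section

open Polynomial Real
open scoped PowerSeries RealInnerProductSpace

theorem exists_eq_pair_of_encard_le_two {X : Type*} {s : Set X} (hs : s.Nonempty)
    (h : s.encard ≤ 2) : ∃ x y, s = {x, y} := by
  obtain ⟨x, hx⟩ := hs
  have hdiff : (s \ {x}).encard ≤ 1 := by
    rw [← ENat.add_le_add_iff_right ENat.one_ne_top, encard_sdiff_singleton_add_one hx]
    exact h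
  rcases encard_le_one_iff_eq.1 hdiff with hempty | ⟨y, hy⟩
  · exact ⟨x, x, by rw [← insert_sdiff_self_of_mem hx, hempty, pair_eq_singleton, insert_empty_eq]⟩
  · exact ⟨x, y, by rw [← insert_sdiff_self_of_mem hx, hy]⟩

theorem encard_pair_le_two {X : Type*} (x y : X) : ({x, y} : Set X).encard ≤ 2 :=
  (encard_insert_le {y} x).trans_eq (by rw [encard_singleton, one_add_one_eq_two])

theorem min_norm_sub_sq {E : Type*} [NormedAddCommGroup E] [InnerProductSpace ℝ E]
    (x m d : E) :
    min (‖x - (m + d)‖ ^ 2) (‖x - (m - d)‖ ^ 2) =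
      ‖x - m‖ ^ 2 + ‖d‖ ^ 2 - 2 * |⟪d, x⟫ - ⟪d, m⟫| := by
  have hadd : ‖x - (m + d)‖ ^ 2 = ‖x - m‖ ^ 2 - 2 * ⟪d, x - m⟫ + ‖d‖ ^ 2 := by
    rw [← sub_sub, norm_sub_sq_real, real_inner_comm]
  have hsub : ‖x - (m - d)‖ ^ 2 = ‖x - m‖ ^ 2 + 2 * ⟪d, x - m⟫ + ‖d‖ ^ 2 := by
    rw [← sub_add, norm_add_sq_real, real_inner_comm]
  rw [hadd, hsub, ← inner_sub_right]
  rcases abs_cases ⟪d, x - m⟫ with ⟨h, h0⟩ | ⟨h, h0⟩ <;> rw [h]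
  · rw [min_eq_left (by linarith)]; ring
  · rw [min_eq_right (by linarith)]; ring

section TwoMeans

variable {E : Type*} [NormedAddCommGroup E] [MeasurableSpace E] {P : Measure E}

theorem distortion_empty [NeZero P] : distortion P ∅ = ∞ := by
  simp [distortion, ENNReal.top_mul, NeZero.ne P]

theorem integrable_norm_sub_sq [IsFiniteMeasure P] (hP : MemLp id 2 P) (a : E) :
    Integrable (fun x => ‖x - a‖ ^ 2) P :=
  (hP.sub (memLp_const a)).integrable_norm_pow two_ne_zero

theorem distortion_pair [IsFiniteMeasure P] (hP : MemLp id 2 P) (p q : E) :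
    distortion P {p, q} = ENNReal.ofReal (∫ x, min (‖x - p‖ ^ 2) (‖x - q‖ ^ 2) ∂P) := by
  have hmin : Integrable (fun x => min (‖x - p‖ ^ 2) (‖x - q‖ ^ 2)) P :=
    (integrable_norm_sub_sq hP p).inf (integrable_norm_sub_sq hP q)
  rw [ofReal_integral_eq_lintegral_ofReal hmin
    (.of_forall fun x => le_min (sq_nonneg _) (sq_nonneg _))]
  simp only [distortion, iInf_pair, ENNReal.ofReal_min]

variable [InnerProductSpace ℝ E]

theorem integrable_inner [IsFiniteMeasure P] (hP : MemLp id 2 P) (d : E) :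
    Integrable (fun x => ⟪d, x⟫) P :=
  (hP.integrable one_le_two).const_inner d

theorem integral_norm_sub_sq [IsProbabilityMeasure P] (hP : MemLp id 2 P)
    (hmean : ∀ d : E, ∫ x, ⟪d, x⟫ ∂P = 0) (m : E) :
    ∫ x, ‖x - m‖ ^ 2 ∂P = ∫ x, ‖x‖ ^ 2 ∂P + ‖m‖ ^ 2 := by
  have hexp : ∀ x : E, ‖x - m‖ ^ 2 = ‖x‖ ^ 2 - 2 * ⟪m, x⟫ + ‖m‖ ^ 2 := fun x => by
    rw [norm_sub_sq_real, real_inner_comm]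
  have hsq : Integrable (fun x => ‖x‖ ^ 2) P := by simpa using integrable_norm_sub_sq hP 0
  have hinner := (integrable_inner hP m).const_mul 2
  have hsub : Integrable (fun x => ‖x‖ ^ 2 - 2 * ⟪m, x⟫) P := hsq.sub hinner
  simp only [hexp]
  rw [integral_add hsub (integrable_const _), integral_sub hsq hinner,
    integral_const_mul, hmean]
  simp

theorem integral_min_norm_sub_sq [IsProbabilityMeasure P] (hP : MemLp id 2 P)
    (hmean : ∀ d : E, ∫ x, ⟪d, x⟫ ∂P = 0) (m d : E) :
    ∫ x, min (‖x - (m + d)‖ ^ 2) (‖x - (m - d)‖ ^ 2) ∂P =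
      ∫ x, ‖x‖ ^ 2 ∂P + ‖m‖ ^ 2 + ‖d‖ ^ 2 - 2 * ∫ x, |⟪d, x⟫ - ⟪d, m⟫| ∂P := by
  have hsq := integrable_norm_sub_sq hP m
  have hadd : Integrable (fun x => ‖x - m‖ ^ 2 + ‖d‖ ^ 2) P := hsq.add (integrable_const _)
  have habs : Integrable (fun x => |⟪d, x⟫ - ⟪d, m⟫|) P :=
    ((integrable_inner hP d).sub (integrable_const _)).abs
  simp only [min_norm_sub_sq]
  rw [integral_sub hadd (habs.const_mul 2),
    integral_add hsq (integrable_const _), integral_const_mul, integral_norm_sub_sq hP hmean]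
  simp

/-- The vector `v` *splits* the measure `P`: the first absolute moments of the affine functions
`x ↦ ⟪d, x⟫ - c` obey a sharp bound which is attained, among the nonconstant ones, by the multiples
of `⟪v, x⟫` only. This is what singles out `{v, -v}` as the optimal set of two-means of a centred
measure. -/
structure Splits (P : Measure E) (v : E) : Prop where
  integral_abs_inner_self : ∫ x, |⟪v, x⟫| ∂P = ‖v‖ ^ 2
  sq_integral_abs_inner_sub_lt : ∀ (d : E) (c : ℝ), d ≠ 0 → (c = 0 → d ∉ Submodule.span ℝ {v}) →
    (∫ x, |⟪d, x⟫ - c| ∂P) ^ 2 < ‖v‖ ^ 2 * ‖d‖ ^ 2 + c ^ 2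

namespace Splits

variable {v : E}

theorem integral_abs_inner_smul (hv : Splits P v) (r : ℝ) :
    ∫ x, |⟪r • v, x⟫| ∂P = |r| * ‖v‖ ^ 2 := by
  simp only [real_inner_smul_left, abs_mul, integral_const_mul, hv.integral_abs_inner_self]

/-- Cauchy–Schwarz for `⟪d, m⟫` followed by AM-GM. -/
theorem two_mul_integral_abs_inner_sub_lt (hv : Splits P v) {d m : E} (hd : d ≠ 0)
    (h : ⟪d, m⟫ = 0 → d ∉ Submodule.span ℝ {v}) :
    2 * ∫ x, |⟪d, x⟫ - ⟪d, m⟫| ∂P < ‖v‖ ^ 2 + ‖m‖ ^ 2 + ‖d‖ ^ 2 := by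
  have hcs : ⟪d, m⟫ ^ 2 ≤ ‖d‖ ^ 2 * ‖m‖ ^ 2 := by
    rw [← mul_pow]
    exact sq_le_sq' (neg_le_of_abs_le (abs_real_inner_le_norm d m)) (real_inner_le_norm d m)
  refine lt_of_pow_lt_pow_left₀ 2 (by positivity) ?_
  calc (2 * ∫ x, |⟪d, x⟫ - ⟪d, m⟫| ∂P) ^ 2
      = 4 * (∫ x, |⟪d, x⟫ - ⟪d, m⟫| ∂P) ^ 2 := by ring
    _ < 4 * (‖v‖ ^ 2 * ‖d‖ ^ 2 + ⟪d, m⟫ ^ 2) := by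
        linarith [hv.sq_integral_abs_inner_sub_lt d ⟪d, m⟫ hd h]
    _ ≤ 4 * ((‖v‖ ^ 2 + ‖m‖ ^ 2) * ‖d‖ ^ 2) := by linarith
    _ ≤ (‖v‖ ^ 2 + ‖m‖ ^ 2 + ‖d‖ ^ 2) ^ 2 := by
        linarith [four_mul_le_sq_add (‖v‖ ^ 2 + ‖m‖ ^ 2) (‖d‖ ^ 2)]

variable [IsProbabilityMeasure P] (hP : MemLp id 2 P) (hmean : ∀ d : E, ∫ x, ⟪d, x⟫ ∂P = 0)
include hP hmean

theorem integral_min_norm_sub_smul_sq (hv : Splits P v) {m : E} {r : ℝ}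
    (h : ⟪r • v, m⟫ = 0) :
    ∫ x, min (‖x - (m + r • v)‖ ^ 2) (‖x - (m - r • v)‖ ^ 2) ∂P =
      ∫ x, ‖x‖ ^ 2 ∂P - ‖v‖ ^ 2 + ‖m‖ ^ 2 + ((|r| - 1) * ‖v‖) ^ 2 := by
  rw [integral_min_norm_sub_sq hP hmean, h]
  simp only [sub_zero, hv.integral_abs_inner_smul, norm_smul, Real.norm_eq_abs]
  ring

theorem integral_min_norm_sub_neg_sq (hv : Splits P v) :
    ∫ x, min (‖x - v‖ ^ 2) (‖x - -v‖ ^ 2) ∂P = ∫ x, ‖x‖ ^ 2 ∂P - ‖v‖ ^ 2 := by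
  simpa using hv.integral_min_norm_sub_smul_sq hP hmean (m := 0) (r := 1) (by simp)

theorem lt_integral_min_norm_sub_sq_or_eq_pair (hv : Splits P v) (p q : E) :
    ∫ x, ‖x‖ ^ 2 ∂P - ‖v‖ ^ 2 < ∫ x, min (‖x - p‖ ^ 2) (‖x - q‖ ^ 2) ∂P ∨
      ({p, q} : Set E) = {v, -v} := by
  obtain ⟨m, d, rfl, rfl⟩ : ∃ m d : E, m + d = p ∧ m - d = q :=
    ⟨(2⁻¹ : ℝ) • (p + q), (2⁻¹ : ℝ) • (p - q), by module, by module⟩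
  by_cases hd : ⟪d, m⟫ = 0 ∧ d ∈ Submodule.span ℝ {v}
  · obtain ⟨h, hspan⟩ := hd
    obtain ⟨r, rfl⟩ := Submodule.mem_span_singleton.1 hspan
    rw [hv.integral_min_norm_sub_smul_sq hP hmean h]
    by_cases hmr : m = 0 ∧ (|r| - 1) * ‖v‖ = 0
    · right
      rw [hmr.1, zero_add, zero_sub]
      rcases mul_eq_zero.1 hmr.2 with hr | hv0
      · rcases eq_or_eq_neg_of_abs_eq (sub_eq_zero.1 hr) with rfl | rfl
        · rw [one_smul]
        · rw [neg_one_smul, neg_neg, pair_comm]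
      · rw [norm_eq_zero.1 hv0, smul_zero]
    · left
      rcases not_and_or.1 hmr with hm | hr
      · have := norm_pos_iff.2 hm
        have : 0 < ‖m‖ ^ 2 + ((|r| - 1) * ‖v‖) ^ 2 := by positivity
        linarith
      · have : 0 < ‖m‖ ^ 2 + ((|r| - 1) * ‖v‖) ^ 2 := by positivity
        linarith
  · left
    have hd0 : d ≠ 0 := by
      rintro rfl
      simp at hd
    rw [integral_min_norm_sub_sq hP hmean]
    linarith [hv.two_mul_integral_abs_inner_sub_lt hd0 (not_and.1 hd)]

theorem le_integral_min_norm_sub_sq (hv : Splits P v) (p q : E) :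
    ∫ x, ‖x‖ ^ 2 ∂P - ‖v‖ ^ 2 ≤ ∫ x, min (‖x - p‖ ^ 2) (‖x - q‖ ^ 2) ∂P := by
  rcases hv.lt_integral_min_norm_sub_sq_or_eq_pair hP hmean p q with h | h
  · exact h.le
  · rw [← hv.integral_min_norm_sub_neg_sq hP hmean]
    rcases pair_eq_pair_iff.1 h with ⟨rfl, rfl⟩ | ⟨rfl, rfl⟩
    · rfl
    · simp only [min_comm, le_refl]

theorem distortion_pair_neg (hv : Splits P v) :
    distortion P {v, -v} = ENNReal.ofReal (∫ x, ‖x‖ ^ 2 ∂P - ‖v‖ ^ 2) := by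
  rw [distortion_pair hP, hv.integral_min_norm_sub_neg_sq hP hmean]

theorem quantizationError_two (hv : Splits P v) :
    quantizationError 2 P = ENNReal.ofReal (∫ x, ‖x‖ ^ 2 ∂P - ‖v‖ ^ 2) := by
  refine le_antisymm ?_ (le_iInf₂ fun α hα => ?_)
  · exact (iInf₂_le ({v, -v} : Set E) (encard_pair_le_two v (-v))).trans_eq
      (hv.distortion_pair_neg hP hmean)
  · rcases α.eq_empty_or_nonempty with rfl | hne
    · rw [distortion_empty]
      exact le_top
    · obtain ⟨p, q, rfl⟩ := exists_eq_pair_of_encard_le_two hne hα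
      rw [distortion_pair hP]
      exact ENNReal.ofReal_le_ofReal (hv.le_integral_min_norm_sub_sq hP hmean p q)

theorem isOptimalSetOfMeans_two_iff (hv : Splits P v) (α : Set E) :
    IsOptimalSetOfMeans 2 P α ↔ α = {v, -v} := by
  rw [IsOptimalSetOfMeans, hv.quantizationError_two hP hmean]
  refine ⟨fun ⟨hα, hopt⟩ => ?_, ?_⟩
  · have hne : α.Nonempty := by
      rw [nonempty_iff_ne_empty]
      rintro rfl
      exact ENNReal.ofReal_ne_top (hopt.symm.trans distortion_empty)
    obtain ⟨p, q, rfl⟩ := exists_eq_pair_of_encard_le_two hne hα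
    rw [distortion_pair hP] at hopt
    refine (hv.lt_integral_min_norm_sub_sq_or_eq_pair hP hmean p q).resolve_left fun hlt => ?_
    have hpos := (integral_nonneg fun x => by positivity).trans_eq
      (hv.integral_min_norm_sub_neg_sq hP hmean)
    exact ((ENNReal.ofReal_lt_ofReal_iff_of_nonneg hpos).2 hlt).ne' hopt
  · rintro rfl
    exact ⟨encard_pair_le_two v (-v), hv.distortion_pair_neg hP hmean⟩

end Splits

end TwoMeans

theorem sq_integral_abs_le_integral_sq {Ω : Type*} [MeasurableSpace Ω] {μ : Measure Ω}
    [IsProbabilityMeasure μ] {f : Ω → ℝ} (hf : MemLp f 2 μ) :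
    (∫ x, |f x| ∂μ) ^ 2 ≤ ∫ x, f x ^ 2 ∂μ := by
  have hvar := ProbabilityTheory.variance_eq_sub hf.abs
  have hnonneg := ProbabilityTheory.variance_nonneg |f| μ
  simp only [Pi.pow_apply, Pi.abs_apply, sq_abs] at hvar
  linarith

theorem integral_abs_sub_eq_abs_of_abs_le {Ω : Type*} [MeasurableSpace Ω] {μ : Measure Ω}
    [IsProbabilityMeasure μ] {f : Ω → ℝ} (hf : Integrable f μ) (hmean : ∫ x, f x ∂μ = 0) {s : ℝ}
    (hs : ∀ᵐ x ∂μ, |f x| ≤ |s|) : ∫ x, |f x - s| ∂μ = |s| := by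
  rcases abs_cases s with ⟨h, -⟩ | ⟨h, -⟩ <;> rw [h] at hs ⊢
  · have habs : (fun x => |f x - s|) =ᵐ[μ] fun x => s - f x := by
      filter_upwards [hs] with x hx
      rw [abs_of_nonpos (by linarith [le_abs_self (f x)]), neg_sub]
    rw [integral_congr_ae habs, integral_sub (integrable_const s) hf, hmean]
    simp
  · have habs : (fun x => |f x - s|) =ᵐ[μ] fun x => f x - s := by
      filter_upwards [hs] with x hx
      rw [abs_of_nonneg (by linarith [neg_abs_le (f x)])]
    rw [integral_congr_ae habs, integral_sub hf (integrable_const s), hmean]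
    simp

section Unconditional

variable {ι : Type*} [Fintype ι] [DecidableEq ι]

/-- The reflection of `EuclideanSpace ℝ ι` which changes the sign of the `i`-th coordinate. -/
def negCoord (i : ι) : EuclideanSpace ℝ ι ≃ₗᵢ[ℝ] EuclideanSpace ℝ ι :=
  LinearIsometryEquiv.piLpCongrRight 2 fun j =>
    if j = i then LinearIsometryEquiv.neg ℝ else LinearIsometryEquiv.refl ℝ ℝ

theorem negCoord_apply_self (i : ι) (x : EuclideanSpace ℝ ι) : negCoord i x i = -x i := by
  simp [negCoord]

theorem negCoord_apply_of_ne {i j : ι} (h : j ≠ i) (x : EuclideanSpace ℝ ι) :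
    negCoord i x j = x j := by
  simp [negCoord, h]

/-- A measure on `EuclideanSpace ℝ ι` is *unconditional* if it is invariant under all sign changes
of the coordinates. -/
def IsUnconditional (P : Measure (EuclideanSpace ℝ ι)) : Prop :=
  ∀ i, MeasurePreserving (negCoord i) P P

namespace IsUnconditional

variable {P : Measure (EuclideanSpace ℝ ι)} (hP : IsUnconditional P)
include hP

theorem integral_comp_negCoord (i : ι) (f : EuclideanSpace ℝ ι → ℝ) :
    ∫ x, f (negCoord i x) ∂P = ∫ x, f x ∂P :=
  (hP i).integral_comp (negCoord i).toHomeomorph.measurableEmbedding f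

theorem integral_eq_zero_of_odd (i : ι) {f : EuclideanSpace ℝ ι → ℝ}
    (hf : ∀ x, f (negCoord i x) = -f x) : ∫ x, f x ∂P = 0 := by
  have h := hP.integral_comp_negCoord i f
  simp only [hf, integral_neg] at h
  linarith

theorem integral_coord_mul_coord {i j : ι} (hij : i ≠ j) : ∫ x, x i * x j ∂P = 0 :=
  hP.integral_eq_zero_of_odd i fun x => by
    rw [negCoord_apply_self, negCoord_apply_of_ne hij.symm, neg_mul]

theorem integral_inner_eq_zero (hint : Integrable id P) (d : EuclideanSpace ℝ ι) :
    ∫ x, ⟪d, x⟫ ∂P = 0 := by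
  have hcoord : ∀ i, Integrable (fun x : EuclideanSpace ℝ ι => x i) P := fun i =>
    (EuclideanSpace.proj (𝕜 := ℝ) i).integrable_comp hint
  simp only [PiLp.inner_apply, RCLike.inner_apply, conj_trivial]
  rw [integral_finsetSum _ fun i _ => (hcoord i).mul_const _]
  refine Finset.sum_eq_zero fun i _ => ?_
  rw [integral_mul_const, hP.integral_eq_zero_of_odd i (negCoord_apply_self i), zero_mul]

end IsUnconditional

end Unconditional

theorem abs_add_abs_neg_add (c v : ℝ) : |c + v| + |-c + v| = 2 * max |c| |v| := by
  grind

/-- As a function of `u` the left-hand side is even and convex. -/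
theorem max_abs_add_max_abs_le (c s t : ℝ) {u : ℝ} (hu : |u| ≤ 1) :
    max c |t * u - s| + max c |t * u + s| ≤ max c |t - s| + max c |t + s| := by
  have hconv : ConvexOn ℝ univ fun y : ℝ => max c |y| :=
    (convexOn_const c convex_univ).sup convexOn_univ_norm
  obtain ⟨hl, hr⟩ := abs_le.1 hu
  have hsum : (1 + u) / 2 + (1 - u) / 2 = 1 := by ring
  have h₁ := hconv.2 (mem_univ (t - s)) (mem_univ (-(t + s))) (by linarith : 0 ≤ (1 + u) / 2)
    (by linarith) hsum
  have h₂ := hconv.2 (mem_univ (t + s)) (mem_univ (-(t - s))) (by linarith : 0 ≤ (1 + u) / 2)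
    (by linarith) hsum
  simp only [smul_eq_mul, abs_neg] at h₁ h₂
  rw [show (1 + u) / 2 * (t - s) + (1 - u) / 2 * -(t + s) = t * u - s by ring] at h₁
  rw [show (1 + u) / 2 * (t + s) + (1 - u) / 2 * -(t - s) = t * u + s by ring] at h₂
  linarith

namespace IsUnconditional

variable {P : Measure Plane} (hP : IsUnconditional P)
include hP

theorem integral_abs_affine_eq [IsFiniteMeasure P] (hint : Integrable id P) (s t : ℝ) :
    ∫ x : Plane, |x 0 + t * x 1 - s| ∂P = ∫ x : Plane, max |x 0| |t * x 1 - s| ∂P := by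
  have hcoord : ∀ i, Integrable (fun x : Plane => x i) P := fun i =>
    (EuclideanSpace.proj (𝕜 := ℝ) i).integrable_comp hint
  have hneg := hP.integral_comp_negCoord 0 fun x : Plane => |x 0 + (t * x 1 - s)|
  simp only [negCoord_apply_self, negCoord_apply_of_ne (one_ne_zero : (1 : Fin 2) ≠ 0)] at hneg
  have hv : Integrable (fun x : Plane => t * x 1 - s) P :=
    ((hcoord 1).const_mul t).sub (integrable_const s)
  have hadd : Integrable (fun x : Plane => |x 0 + (t * x 1 - s)|) P := ((hcoord 0).add hv).abs
  have hsub : Integrable (fun x : Plane => |-x 0 + (t * x 1 - s)|) P := ((hcoord 0).neg.add hv).abs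
  have hsum := integral_add hadd hsub
  simp only [abs_add_abs_neg_add, integral_const_mul, hneg] at hsum
  simp only [add_sub_assoc]
  linarith

theorem two_mul_integral_abs_affine_le [IsFiniteMeasure P] (hint : Integrable id P)
    (h₁ : ∀ᵐ x ∂P, |x 1| ≤ 1) (s t : ℝ) :
    2 * ∫ x : Plane, |x 0 + t * x 1 - s| ∂P ≤
      ∫ x : Plane, max |x 0| |t - s| ∂P + ∫ x : Plane, max |x 0| |t + s| ∂P := by
  have hcoord : ∀ i, Integrable (fun x : Plane => x i) P := fun i =>
    (EuclideanSpace.proj (𝕜 := ℝ) i).integrable_comp hint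
  have hneg := hP.integral_comp_negCoord 1 fun x : Plane => max |x 0| |t * x 1 - s|
  simp only [negCoord_apply_self, negCoord_apply_of_ne (zero_ne_one : (0 : Fin 2) ≠ 1)] at hneg
  have hneg' : ∫ x : Plane, max |x 0| |t * x 1 + s| ∂P =
      ∫ x : Plane, max |x 0| |t * x 1 - s| ∂P := by
    rw [← hneg]
    refine integral_congr_ae (.of_forall fun x => ?_)
    simp only [mul_neg, ← neg_add', abs_neg]
  have hmax : ∀ r : ℝ, Integrable (fun x : Plane => max |x 0| |t * x 1 + r|) P := fun r =>
    (hcoord 0).abs.sup (((hcoord 1).const_mul t).add (integrable_const r)).abs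
  have hmax' : ∀ r : ℝ, Integrable (fun x : Plane => max |x 0| r) P := fun r =>
    (hcoord 0).abs.sup (integrable_const r)
  have hsub : Integrable (fun x : Plane => max |x 0| |t * x 1 - s|) P := by
    simpa only [sub_eq_add_neg] using hmax (-s)
  calc 2 * ∫ x : Plane, |x 0 + t * x 1 - s| ∂P
      = ∫ x : Plane, (max |x 0| |t * x 1 - s| + max |x 0| |t * x 1 + s|) ∂P := by
        rw [hP.integral_abs_affine_eq hint, integral_add hsub (hmax s), hneg', two_mul]
    _ ≤ ∫ x : Plane, (max |x 0| |t - s| + max |x 0| |t + s|) ∂P := by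
        refine integral_mono_ae (hsub.add (hmax s)) ((hmax' _).add (hmax' _)) ?_
        filter_upwards [h₁] with x hx using max_abs_add_max_abs_le _ s t hx
    _ = _ := integral_add (hmax' _) (hmax' _)

theorem integral_abs_affine_le [IsFiniteMeasure P] (hint : Integrable id P)
    (h₁ : ∀ᵐ x ∂P, |x 1| ≤ 1) {a : ℝ}
    (ha : ∀ k, 0 ≤ k → ∫ x : Plane, max |x 0| k ∂P ≤ a + k ^ 2 / 4) (s t : ℝ) :
    ∫ x : Plane, |x 0 + t * x 1 - s| ∂P ≤ a + (t ^ 2 + s ^ 2) / 4 := by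
  have hsub := ha |t - s| (abs_nonneg _)
  have hadd := ha |t + s| (abs_nonneg _)
  rw [sq_abs] at hsub hadd
  linarith [hP.two_mul_integral_abs_affine_le hint h₁ s t]

end IsUnconditional

section Curve

variable {γ : ℝ → Plane} {s t : ℝ}

theorem arcLengthMeasure_univ (hγ : Continuous γ) :
    arcLengthMeasure γ s t univ = ∫⁻ θ in Icc s t, ‖deriv γ θ‖ₑ := by
  rw [arcLengthMeasure, Measure.map_apply hγ.measurable .univ, preimage_univ,
    withDensity_apply _ .univ, Measure.restrict_univ]

theorem integral_arcLengthMeasure (hγ : Continuous γ) {f : Plane → ℝ} (hf : StronglyMeasurable f) :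
    ∫ x, f x ∂arcLengthMeasure γ s t = ∫ θ in Icc s t, ‖deriv γ θ‖ * f (γ θ) := by
  rw [arcLengthMeasure, integral_map hγ.measurable.aemeasurable hf.aestronglyMeasurable]
  exact integral_withDensity_eq_integral_smul (measurable_deriv γ).nnnorm _

theorem toReal_arcLengthMeasure_univ (hγ : Continuous γ) :
    (arcLengthMeasure γ s t univ).toReal = ∫ θ in Icc s t, ‖deriv γ θ‖ := by
  rw [arcLengthMeasure_univ hγ,
    integral_norm_eq_lintegral_enorm (measurable_deriv γ).aestronglyMeasurable]

theorem integral_uniformOnCurve (hγ : Continuous γ) {f : Plane → ℝ} (hf : StronglyMeasurable f) :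
    ∫ x, f x ∂uniformOnCurve γ s t =
      (∫ θ in Icc s t, ‖deriv γ θ‖ * f (γ θ)) / ∫ θ in Icc s t, ‖deriv γ θ‖ := by
  rw [uniformOnCurve, integral_smul_measure, ENNReal.toReal_inv, toReal_arcLengthMeasure_univ hγ,
    integral_arcLengthMeasure hγ hf, smul_eq_mul, inv_mul_eq_div]

theorem isProbabilityMeasure_uniformOnCurve (hγ : Continuous γ)
    (hlength : 0 < ∫ θ in Icc s t, ‖deriv γ θ‖) : IsProbabilityMeasure (uniformOnCurve γ s t) := by
  rw [← toReal_arcLengthMeasure_univ hγ, ENNReal.toReal_pos_iff] at hlength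
  exact ⟨ENNReal.inv_mul_cancel hlength.1.ne' hlength.2.ne⟩

theorem ae_uniformOnCurve_mem_image (hγ : Continuous γ) :
    ∀ᵐ x ∂uniformOnCurve γ s t, x ∈ γ '' Icc s t := by
  refine Measure.ae_smul_measure ?_ _
  have hmeas : MeasurableSet (γ '' Icc s t) := (isCompact_Icc.image hγ).measurableSet
  refine (ae_map_iff (p := (· ∈ γ '' Icc s t)) hγ.measurable.aemeasurable hmeas).2 <|
    withDensity_absolutelyContinuous _ _ ?_
  filter_upwards [ae_restrict_mem measurableSet_Icc] with θ hθ using mem_image_of_mem γ hθ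

theorem memLp_uniformOnCurve [IsFiniteMeasure (uniformOnCurve γ s t)] (hγ : Continuous γ)
    {F : Type*} [NormedAddCommGroup F] [SecondCountableTopologyEither Plane F] {f : Plane → F}
    (hf : Continuous f) (p : ℝ≥0∞) : MemLp f p (uniformOnCurve γ s t) := by
  obtain ⟨C, hC⟩ := (isCompact_Icc.image hγ).exists_bound_of_continuousOn (s := γ '' Icc s t)
    hf.continuousOn
  refine .of_bound hf.aestronglyMeasurable C ?_
  filter_upwards [ae_uniformOnCurve_mem_image hγ] with x hx using hC x hx

end Curve

theorem integral_comp_sub_left_of_periodic {f : ℝ → ℝ} {T : ℝ} (hf : f.Periodic T) (c : ℝ) :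
    ∫ x in 0..T, f (c - x) = ∫ x in 0..T, f x := by
  have h := hf.intervalIntegral_add_eq (c - T) 0
  rw [intervalIntegral.integral_comp_sub_left, sub_zero, ← zero_add T, ← h, zero_add,
    sub_add_cancel]

section Ellipse

/-- The speed `‖ellipseParam' θ‖` of the parametrisation, written in terms of `sin θ` alone. -/
def ellipseSpeed (θ : ℝ) : ℝ := √(1 + 3 * sin θ ^ 2)

/-- The length `A` of the ellipse `x₁² + 4 x₂² = 4`. -/
def ellipsePerimeter : ℝ := ∫ θ in 0..2 * π, ellipseSpeed θ

theorem ellipseSpeed_sq (θ : ℝ) : ellipseSpeed θ ^ 2 = 1 + 3 * sin θ ^ 2 :=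
  sq_sqrt (by positivity)

theorem ellipseSpeed_pos (θ : ℝ) : 0 < ellipseSpeed θ :=
  sqrt_pos.2 (by positivity)

@[fun_prop]
theorem continuous_ellipseSpeed : Continuous ellipseSpeed := by
  unfold ellipseSpeed
  fun_prop

@[fun_prop]
theorem continuous_ellipseParam : Continuous ellipseParam := by
  unfold ellipseParam
  fun_prop

theorem ellipseSpeed_neg (θ : ℝ) : ellipseSpeed (-θ) = ellipseSpeed θ := by
  simp [ellipseSpeed]

theorem ellipseSpeed_pi_sub (θ : ℝ) : ellipseSpeed (π - θ) = ellipseSpeed θ := by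
  simp [ellipseSpeed]

theorem ellipseSpeed_periodic : ellipseSpeed.Periodic π := fun θ => by
  simp [ellipseSpeed]

theorem ellipseParam_periodic : ellipseParam.Periodic (2 * π) := fun θ => by
  simp [ellipseParam]

theorem hasDerivAt_ellipseParam (θ : ℝ) :
    HasDerivAt ellipseParam !₂[-(2 * sin θ), cos θ] θ := by
  have hcoord : HasDerivAt (fun θ => ![2 * cos θ, sin θ]) ![-(2 * sin θ), cos θ] θ :=
    hasDerivAt_pi.2 <| Fin.forall_fin_two.2
      ⟨by simpa using (hasDerivAt_cos θ).const_mul 2, hasDerivAt_sin θ⟩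
  exact (PiLp.hasFDerivAt_toLp 2 _).comp_hasDerivAt θ hcoord

theorem norm_deriv_ellipseParam (θ : ℝ) : ‖deriv ellipseParam θ‖ = ellipseSpeed θ := by
  rw [(hasDerivAt_ellipseParam θ).deriv, EuclideanSpace.norm_eq, Fin.sum_univ_two, ellipseSpeed]
  congr 1
  simp only [Matrix.cons_val_zero, Matrix.cons_val_one, norm_eq_abs, sq_abs]
  linear_combination cos_sq_add_sin_sq θ

theorem ellipsePerimeter_pos : 0 < ellipsePerimeter :=
  intervalIntegral.intervalIntegral_pos_of_pos
    (continuous_ellipseSpeed.intervalIntegrable _ _) ellipseSpeed_pos two_pi_pos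

theorem integral_norm_deriv_ellipseParam :
    ∫ θ in Icc 0 (2 * π), ‖deriv ellipseParam θ‖ = ellipsePerimeter := by
  simp only [norm_deriv_ellipseParam]
  rw [integral_Icc_eq_integral_Ioc, ← intervalIntegral.integral_of_le two_pi_pos.le,
    ellipsePerimeter]

instance isProbabilityMeasure_ellipseUniform : IsProbabilityMeasure ellipseUniform :=
  isProbabilityMeasure_uniformOnCurve continuous_ellipseParam
    (integral_norm_deriv_ellipseParam ▸ ellipsePerimeter_pos)

theorem integral_ellipseUniform {f : Plane → ℝ} (hf : Continuous f) :
    ∫ x, f x ∂ellipseUniform =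
      (∫ θ in 0..2 * π, ellipseSpeed θ * f (ellipseParam θ)) / ellipsePerimeter := by
  rw [ellipseUniform, integral_uniformOnCurve continuous_ellipseParam hf.stronglyMeasurable,
    integral_norm_deriv_ellipseParam]
  simp only [norm_deriv_ellipseParam]
  rw [integral_Icc_eq_integral_Ioc, ← intervalIntegral.integral_of_le two_pi_pos.le]

theorem memLp_ellipseUniform {F : Type*} [NormedAddCommGroup F]
    [SecondCountableTopologyEither Plane F] {f : Plane → F} (hf : Continuous f) (p : ℝ≥0∞) :
    MemLp f p ellipseUniform :=
  have : IsFiniteMeasure (uniformOnCurve ellipseParam 0 (2 * π)) :=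
    inferInstanceAs (IsFiniteMeasure ellipseUniform)
  memLp_uniformOnCurve continuous_ellipseParam hf p

theorem integrable_ellipseUniform {F : Type*} [NormedAddCommGroup F]
    [SecondCountableTopologyEither Plane F] {f : Plane → F} (hf : Continuous f) :
    Integrable f ellipseUniform :=
  memLp_one_iff_integrable.1 (memLp_ellipseUniform hf 1)

theorem ae_ellipseUniform : ∀ᵐ x ∂ellipseUniform, x 0 ^ 2 + 4 * x 1 ^ 2 = 4 := by
  have h := ae_uniformOnCurve_mem_image (s := 0) (t := 2 * π) continuous_ellipseParam
  rwa [ellipseParam_image] at h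

theorem negCoord_zero_ellipseParam (θ : ℝ) :
    negCoord 0 (ellipseParam θ) = ellipseParam (π - θ) := by
  ext i
  fin_cases i <;> simp [negCoord, ellipseParam]

theorem negCoord_one_ellipseParam (θ : ℝ) :
    negCoord 1 (ellipseParam θ) = ellipseParam (-θ) := by
  ext i
  fin_cases i <;> simp [negCoord, ellipseParam]

theorem measurePreserving_negCoord_ellipseUniform {i : Fin 2} {c : ℝ}
    (hparam : ∀ θ, negCoord i (ellipseParam θ) = ellipseParam (c - θ))
    (hspeed : ∀ θ, ellipseSpeed (c - θ) = ellipseSpeed θ) :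
    MeasurePreserving (negCoord i) ellipseUniform ellipseUniform := by
  refine ⟨(negCoord i).continuous.measurable, ?_⟩
  have := Measure.isProbabilityMeasure_map (μ := ellipseUniform)
    (negCoord i).continuous.measurable.aemeasurable
  refine ext_of_forall_integral_eq_of_IsFiniteMeasure fun f => ?_
  have hf := f.continuous
  have hperiodic : (fun θ => ellipseSpeed θ * f (ellipseParam θ)).Periodic (2 * π) := fun θ => by
    have hspeed_add : ellipseSpeed (θ + 2 * π) = ellipseSpeed θ :=
      mod_cast ellipseSpeed_periodic.nat_mul 2 θ
    simp only [ellipseParam_periodic θ, hspeed_add]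
  rw [integral_map (negCoord i).continuous.measurable.aemeasurable
    hf.stronglyMeasurable.aestronglyMeasurable,
    integral_ellipseUniform (f := fun x => f (negCoord i x)) (by fun_prop),
    integral_ellipseUniform hf, ← integral_comp_sub_left_of_periodic hperiodic c]
  simp only [hparam, hspeed]

theorem isUnconditional_ellipseUniform : IsUnconditional ellipseUniform := by
  refine Fin.forall_fin_two.2 ⟨?_, ?_⟩
  · exact measurePreserving_negCoord_ellipseUniform negCoord_zero_ellipseParam ellipseSpeed_pi_sub
  · refine measurePreserving_negCoord_ellipseUniform (c := 0) ?_ ?_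
    · simpa only [zero_sub] using negCoord_one_ellipseParam
    · simpa only [zero_sub] using ellipseSpeed_neg

theorem integral_sqrt_one_add_sq (b : ℝ) :
    ∫ x in 0..b, √(1 + x ^ 2) = (b * √(1 + b ^ 2) + arsinh b) / 2 := by
  have hderiv : ∀ x ∈ uIcc 0 b,
      HasDerivAt (fun x => (x * √(1 + x ^ 2) + arsinh x) / 2) √(1 + x ^ 2) x := fun x _ => by
    have hpos : 0 < 1 + x ^ 2 := by positivity
    have hsqrt := ((hasDerivAt_pow 2 x).const_add 1).sqrt hpos.ne'
    refine ((((hasDerivAt_id x).mul hsqrt).add (hasDerivAt_arsinh x)).div_const 2).congr_deriv ?_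
    have := sqrt_pos.2 hpos
    simp only [id]
    field_simp
    rw [sq_sqrt hpos.le]
    ring
  rw [intervalIntegral.integral_eq_sub_of_hasDerivAt hderiv
    (Continuous.intervalIntegrable (by fun_prop) _ _)]
  simp

theorem integral_zero_two_pi_eq_four_mul {f : ℝ → ℝ} (hf : Continuous f) (hper : f.Periodic π)
    (hrefl : ∀ θ, f (π - θ) = f θ) : ∫ θ in 0..2 * π, f θ = 4 * ∫ θ in 0..π / 2, f θ := by
  have hint : ∀ a b, IntervalIntegrable f volume a b := hf.intervalIntegrable
  have hhalf : ∫ θ in π..2 * π, f θ = ∫ θ in 0..π, f θ := by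
    simpa [two_mul] using hper.intervalIntegral_add_eq π 0
  have hquarter : ∫ θ in π / 2..π, f θ = ∫ θ in 0..π / 2, f θ := by
    have h := intervalIntegral.integral_comp_sub_left f π (a := 0) (b := π / 2)
    rw [sub_zero, sub_half] at h
    rw [← h]
    simp only [hrefl]
  rw [← intervalIntegral.integral_add_adjacent_intervals (hint 0 π) (hint π _), hhalf,
    ← intervalIntegral.integral_add_adjacent_intervals (hint 0 (π / 2)) (hint (π / 2) _), hquarter]
  ring

theorem integral_comp_abs_fst_ellipseUniform {φ : ℝ → ℝ} (hφ : Continuous φ) :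
    ∫ x, φ |x 0| ∂ellipseUniform =
      4 * (∫ θ in 0..π / 2, φ (2 * cos θ) * ellipseSpeed θ) / ellipsePerimeter := by
  rw [integral_ellipseUniform (by fun_prop), integral_zero_two_pi_eq_four_mul (by fun_prop)]
  · congr 2
    refine intervalIntegral.integral_congr fun θ hθ => ?_
    rw [uIcc_of_le pi_div_two_pos.le] at hθ
    have hcos : 0 ≤ cos θ := cos_nonneg_of_mem_Icc ⟨by linarith [hθ.1, pi_pos], hθ.2⟩
    simp only [ellipseParam, Matrix.cons_val_zero]
    rw [abs_of_nonneg (by positivity), mul_comm]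
  · intro θ
    simp only [ellipseSpeed_periodic θ]
    simp [ellipseParam]
  · intro θ
    simp only [ellipseSpeed_pi_sub]
    simp [ellipseParam]

theorem integral_ellipseSpeed_quarter : ∫ θ in 0..π / 2, ellipseSpeed θ = ellipsePerimeter / 4 := by
  have h := integral_comp_abs_fst_ellipseUniform (φ := fun _ => 1) continuous_const
  have hpos := ellipsePerimeter_pos
  simp only [integral_const, probReal_univ, smul_eq_mul, one_mul] at h
  field_simp at h
  linarith

theorem integral_cos_mul_ellipseSpeed_quarter :
    ∫ θ in 0..π / 2, cos θ * ellipseSpeed θ = 1 + arsinh √3 / √3 / 2 := by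
  have hsubst := intervalIntegral.integral_comp_mul_deriv (a := 0) (b := π / 2)
    (f := fun θ => √3 * sin θ) (g := fun x => √(1 + x ^ 2))
    (fun θ _ => (hasDerivAt_sin θ).const_mul √3) (by fun_prop) (by fun_prop)
  have hspeed : ∀ θ, √(1 + (√3 * sin θ) ^ 2) * (√3 * cos θ) = √3 * (cos θ * ellipseSpeed θ) :=
    fun θ => by
      rw [mul_pow, sq_sqrt zero_le_three, ellipseSpeed]
      ring
  have h2 : √(1 + √3 ^ 2) = 2 := by
    rw [sq_sqrt zero_le_three, sqrt_eq_iff_mul_self_eq_of_pos two_pos]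
    norm_num
  simp only [Function.comp_apply, hspeed, intervalIntegral.integral_const_mul, sin_zero, mul_zero,
    sin_pi_div_two, mul_one, integral_sqrt_one_add_sq, h2] at hsubst
  field_simp
  linarith

theorem integral_abs_fst_ellipseUniform :
    ∫ x, |x 0| ∂ellipseUniform = (8 + 4 * (arsinh √3 / √3)) / ellipsePerimeter := by
  rw [integral_comp_abs_fst_ellipseUniform (φ := fun y => y) continuous_id]
  simp only [mul_assoc, intervalIntegral.integral_const_mul, integral_cos_mul_ellipseSpeed_quarter]
  ring

theorem integral_snd_sq_ellipseUniform :
    ∫ x, x 1 ^ 2 ∂ellipseUniform =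
      (1 - (∫ θ in 0..2 * π, cos (2 * θ) * ellipseSpeed θ) / ellipsePerimeter) / 2 := by
  have hsin : ∀ θ, ellipseSpeed θ * ellipseParam θ 1 ^ 2 =
      1 / 2 * ellipseSpeed θ - 1 / 2 * (cos (2 * θ) * ellipseSpeed θ) := fun θ => by
    simp only [ellipseParam, Matrix.cons_val_one, Matrix.cons_val_fin_one, sin_sq_eq_half_sub]
    ring
  rw [integral_ellipseUniform (by fun_prop)]
  simp only [hsin]
  rw [intervalIntegral.integral_sub (Continuous.intervalIntegrable (by fun_prop) _ _)
    (Continuous.intervalIntegrable (by fun_prop) _ _), intervalIntegral.integral_const_mul,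
    intervalIntegral.integral_const_mul, ← ellipsePerimeter]
  have := ellipsePerimeter_pos
  field_simp

theorem integral_fst_sq_ellipseUniform :
    ∫ x, x 0 ^ 2 ∂ellipseUniform = 4 - 4 * ∫ x, x 1 ^ 2 ∂ellipseUniform := by
  have hellipse : (fun x : Plane => x 0 ^ 2) =ᵐ[ellipseUniform] fun x => 4 - 4 * x 1 ^ 2 := by
    filter_upwards [ae_ellipseUniform] with x hx
    linarith
  rw [integral_congr_ae hellipse, integral_sub (integrable_const _)
    (integrable_ellipseUniform (by fun_prop)), integral_const_mul]
  simp

end Ellipse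

section CircleAverage

theorem circleAverage_norm_eval_sq (p : ℂ[X]) {N : ℕ} (hp : p.natDegree < N) :
    circleAverage (fun z => ‖p.eval z‖ ^ 2) 0 1 = ∑ k ∈ Finset.range N, ‖p.coeff k‖ ^ 2 := by
  rw [← p.sum_sq_norm_coeff_eq_circleAverage]
  refine Finset.sum_subset (fun k hk => ?_) fun k _ hk => ?_
  · exact Finset.mem_range.2 ((le_natDegree_of_mem_supp k hk).trans_lt hp)
  · rw [notMem_support_iff.1 hk, norm_zero, zero_pow two_ne_zero]

theorem circleIntegrable_of_continuous {f : ℂ → ℝ} (hf : Continuous f) (c : ℂ) (R : ℝ) :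
    CircleIntegrable f c R :=
  (hf.comp (continuous_circleMap c R)).intervalIntegrable _ _

/-- Parseval's identity, by polarization. -/
theorem circleAverage_inner_eval (p q : ℂ[X]) {N : ℕ} (hp : p.natDegree < N)
    (hq : q.natDegree < N) :
    circleAverage (fun z => ⟪p.eval z, q.eval z⟫) 0 1 =
      ∑ k ∈ Finset.range N, ⟪p.coeff k, q.coeff k⟫ := by
  have hpolar : ∀ w z : ℂ, ⟪w, z⟫ = 2⁻¹ * (‖w + z‖ ^ 2 - ‖w‖ ^ 2 - ‖z‖ ^ 2) := fun w z => by
    rw [norm_add_sq_real]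
    ring
  have hint : ∀ r : ℂ[X], CircleIntegrable (fun z => ‖r.eval z‖ ^ 2) 0 1 := fun r =>
    circleIntegrable_of_continuous (by fun_prop) 0 1
  have hpq : (p + q).natDegree < N := (natDegree_add_le p q).trans_lt (max_lt hp hq)
  have havg : circleAverage (fun z => ‖p.eval z + q.eval z‖ ^ 2 - ‖p.eval z‖ ^ 2 - ‖q.eval z‖ ^ 2)
      0 1 = ∑ k ∈ Finset.range N,
        (‖p.coeff k + q.coeff k‖ ^ 2 - ‖p.coeff k‖ ^ 2 - ‖q.coeff k‖ ^ 2) := by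
    have hsub : CircleIntegrable (fun z => ‖(p + q).eval z‖ ^ 2 - ‖p.eval z‖ ^ 2) 0 1 :=
      (hint _).sub (hint p)
    simp only [← eval_add, ← coeff_add, Finset.sum_sub_distrib]
    rw [circleAverage_fun_sub hsub (hint q),
      circleAverage_fun_sub (hint _) (hint p), circleAverage_norm_eval_sq _ hpq,
      circleAverage_norm_eval_sq _ hp, circleAverage_norm_eval_sq _ hq]
  simp only [hpolar, ← Finset.mul_sum, ← havg]
  exact circleAverage_fun_smul (a := (2⁻¹ : ℝ))

theorem abs_circleAverage_sub_le {f g : ℂ → ℝ} (hf : Continuous f) (hg : Continuous g) {c : ℂ}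
    {R ε : ℝ} (h : ∀ z ∈ Metric.sphere c |R|, |f z - g z| ≤ ε) :
    |circleAverage f c R - circleAverage g c R| ≤ ε := by
  rw [← circleAverage_sub (circleIntegrable_of_continuous hf c R)
    (circleIntegrable_of_continuous hg c R)]
  exact abs_circleAverage_le_circleAverage_abs.trans
    (circleAverage_mono_on_of_le_circle (circleIntegrable_of_continuous (hf.sub hg).abs c R) h)

theorem circleAverage_zero_one_eq_integral_two_mul {f : ℂ → ℝ} (hf : Continuous f) :
    2 * π * circleAverage f 0 1 = ∫ θ in 0..2 * π, f (circleMap 0 1 (2 * θ)) := by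
  have hper : (fun θ => f (circleMap 0 1 θ)).Periodic (2 * π) := fun θ =>
    congrArg f (periodic_circleMap 0 1 θ)
  have htwice : ∫ θ in 0..2 * (2 * π), f (circleMap 0 1 θ) =
      2 * ∫ θ in 0..2 * π, f (circleMap 0 1 θ) := by
    simpa using hper.intervalIntegral_add_zsmul_eq 2 0 fun _ _ =>
      (hf.comp (continuous_circleMap 0 1)).intervalIntegrable _ _
  rw [intervalIntegral.integral_comp_mul_left (fun θ => f (circleMap 0 1 θ)) two_ne_zero, mul_zero,
    htwice, circleAverage_def, smul_eq_mul, smul_eq_mul, mul_inv_cancel_left₀ two_pi_pos.ne',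
    inv_mul_cancel_left₀ two_ne_zero]

end CircleAverage

section SquareRootSeries

theorem norm_eval_map_le_eval_norm {p : ℝ[X]} (hp : ∀ n, 0 ≤ p.coeff n) (z : ℂ) :
    ‖(p.map Complex.ofRealHom).eval z‖ ≤ p.eval ‖z‖ := by
  rw [eval_map, eval₂_eq_sum_range, eval_eq_sum_range]
  refine (norm_sum_le _ _).trans_eq (Finset.sum_congr rfl fun n _ => ?_)
  simp [abs_of_nonneg (hp n)]

/-- The Taylor series at `0` of `√(1 - 4 x)`, whose coefficients are, up to a factor `-2`, the
Catalan numbers. -/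
def sqrtSeries : ℝ⟦X⟧ :=
  1 - 2 * PowerSeries.X * PowerSeries.catalanSeries.map (Nat.castRingHom ℝ)

theorem sqrtSeries_sq : sqrtSeries ^ 2 = 1 - 4 * PowerSeries.X := by
  have h := congrArg (PowerSeries.map (Nat.castRingHom ℝ))
    PowerSeries.catalanSeries_sq_mul_X_add_one
  simp only [map_add, map_mul, map_pow, map_one, PowerSeries.map_X] at h
  rw [sqrtSeries]
  linear_combination 4 * PowerSeries.X * h

theorem coeff_zero_sqrtSeries : PowerSeries.coeff 0 sqrtSeries = 1 := by
  simp [sqrtSeries]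

theorem coeff_succ_sqrtSeries (n : ℕ) :
    PowerSeries.coeff (n + 1) sqrtSeries = -2 * catalan n := by
  rw [sqrtSeries, mul_assoc, map_sub, ← map_ofNat (PowerSeries.C (R := ℝ)),
    PowerSeries.coeff_C_mul, PowerSeries.coeff_succ_X_mul]
  simp [PowerSeries.coeff_one]

theorem coeff_trunc_sqrtSeries_sq_sub_nonneg (N n : ℕ) :
    0 ≤ ((PowerSeries.trunc (N + 1) sqrtSeries) ^ 2 - (1 - 4 * X)).coeff n := by
  have hcoe : ((1 - 4 * X : ℝ[X]) : ℝ⟦X⟧) = sqrtSeries ^ 2 := by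
    rw [sqrtSeries_sq, ← map_ofNat C, ← map_ofNat (PowerSeries.C (R := ℝ))]
    simp only [coe_sub, coe_one, coe_mul, coe_C, coe_X]
  rcases lt_or_ge n (N + 1) with hn | hn
  · have h := PowerSeries.coeff_mul_eq_coeff_trunc_mul_trunc sqrtSeries sqrtSeries hn
    rw [← sq, ← hcoe, ← sq, Polynomial.coeff_coe] at h
    rw [coeff_sub, h, ← Polynomial.coeff_coe, coe_pow, sub_self]
  · have hlin : (1 - 4 * X : ℝ[X]).coeff n ≤ 0 := by
      rw [← map_ofNat C, coeff_sub, coeff_C_mul, coeff_one, coeff_X, if_neg (show n ≠ 0 by omega)]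
      split_ifs <;> norm_num
    rw [coeff_sub, sq, coeff_mul]
    refine sub_nonneg.2 (hlin.trans (Finset.sum_nonneg fun ij hij => ?_))
    rw [Finset.HasAntidiagonal.mem_antidiagonal] at hij
    simp only [PowerSeries.coeff_trunc]
    split_ifs with hi hj
    · obtain ⟨i, hi'⟩ := Nat.exists_eq_succ_of_ne_zero (show ij.1 ≠ 0 by omega)
      obtain ⟨j, hj'⟩ := Nat.exists_eq_succ_of_ne_zero (show ij.2 ≠ 0 by omega)
      rw [hi', hj', coeff_succ_sqrtSeries, coeff_succ_sqrtSeries]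
      rw [mul_mul_mul_comm]
      positivity
    all_goals simp

/-- The coefficients of the error being nonnegative, it is largest on the positive real axis. -/
theorem norm_eval_trunc_sqrtSeries_sq_sub_le (N : ℕ) (z : ℂ) :
    ‖((PowerSeries.trunc (N + 1) sqrtSeries).map Complex.ofRealHom).eval z ^ 2 - (1 - 4 * z)‖ ≤
      (PowerSeries.trunc (N + 1) sqrtSeries).eval ‖z‖ ^ 2 - (1 - 4 * ‖z‖) := by
  simpa using norm_eval_map_le_eval_norm (coeff_trunc_sqrtSeries_sq_sub_nonneg N) z

/-- The Taylor polynomial of degree `N` of `z ↦ √(1 - 4 r z)`. -/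
def sqrtPolynomial (N : ℕ) (r : ℝ) : ℂ[X] :=
  ((PowerSeries.trunc (N + 1) sqrtSeries).map Complex.ofRealHom).comp (C (r : ℂ) * X)

theorem coeff_sqrtPolynomial {N k : ℕ} (hk : k < N + 1) (r : ℝ) :
    (sqrtPolynomial N r).coeff k = (PowerSeries.coeff k sqrtSeries * r ^ k : ℝ) := by
  rw [sqrtPolynomial, comp_C_mul_X_coeff, coeff_map, PowerSeries.coeff_trunc, if_pos hk]
  simp

theorem natDegree_sqrtPolynomial_lt (N : ℕ) (r : ℝ) : (sqrtPolynomial N r).natDegree < N + 1 := by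
  refine natDegree_comp_le.trans_lt ((Nat.mul_le_mul le_rfl
    ((natDegree_C_mul_le _ X).trans natDegree_X_le)).trans_lt ?_)
  rw [mul_one]
  exact (natDegree_map_le).trans_lt (PowerSeries.natDegree_trunc_lt sqrtSeries N)

theorem abs_norm_eval_sqrtPolynomial_sq_sub_le (N : ℕ) {r : ℝ} (hr : 0 ≤ r) {z : ℂ}
    (hz : ‖z‖ = 1) :
    |‖(sqrtPolynomial N r).eval z‖ ^ 2 - ‖1 - 4 * (r * z)‖| ≤
      (PowerSeries.trunc (N + 1) sqrtSeries).eval r ^ 2 - (1 - 4 * r) := by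
  have hrz : ‖(r : ℂ) * z‖ = r := by
    rw [norm_mul, hz, mul_one, Complex.norm_real, norm_of_nonneg hr]
  have h := norm_eval_trunc_sqrtSeries_sq_sub_le N (r * z)
  rw [hrz] at h
  rw [← norm_pow]
  refine (abs_norm_sub_norm_le _ _).trans (h.trans_eq' ?_)
  simp [sqrtPolynomial]

theorem abs_circleAverage_norm_one_sub_sub_le (N : ℕ) {r : ℝ} (hr : 0 ≤ r) :
    |circleAverage (fun z => ‖1 - 4 * (r * z)‖) 0 1 -
        ∑ k ∈ Finset.range (N + 1), (PowerSeries.coeff k sqrtSeries * r ^ k) ^ 2| ≤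
      (PowerSeries.trunc (N + 1) sqrtSeries).eval r ^ 2 - (1 - 4 * r) := by
  have hsum : circleAverage (fun z => ‖(sqrtPolynomial N r).eval z‖ ^ 2) 0 1 =
      ∑ k ∈ Finset.range (N + 1), (PowerSeries.coeff k sqrtSeries * r ^ k) ^ 2 := by
    rw [circleAverage_norm_eval_sq _ (natDegree_sqrtPolynomial_lt N r)]
    refine Finset.sum_congr rfl fun k hk => ?_
    rw [coeff_sqrtPolynomial (Finset.mem_range.1 hk), Complex.norm_real, norm_eq_abs, sq_abs]
  rw [← hsum, abs_sub_comm]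
  refine abs_circleAverage_sub_le (by fun_prop) (by fun_prop) fun z hz => ?_
  exact abs_norm_eval_sqrtPolynomial_sq_sub_le N hr (by simpa using hz)

theorem abs_circleAverage_re_mul_norm_one_sub_sub_le (N : ℕ) {r : ℝ} (hr : 0 ≤ r) :
    |circleAverage (fun z => z.re * ‖1 - 4 * (r * z)‖) 0 1 -
        ∑ k ∈ Finset.range N, PowerSeries.coeff k sqrtSeries * r ^ k *
          (PowerSeries.coeff (k + 1) sqrtSeries * r ^ (k + 1))| ≤
      (PowerSeries.trunc (N + 1) sqrtSeries).eval r ^ 2 - (1 - 4 * r) := by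
  set p := sqrtPolynomial N r with hp
  have hdeg : p.natDegree < N + 1 := natDegree_sqrtPolynomial_lt N r
  have hinner : ∀ z : ℂ, z.re * ‖p.eval z‖ ^ 2 = ⟪p.eval z, (X * p).eval z⟫ := fun z => by
    rw [eval_mul, eval_X, Complex.inner, mul_assoc, Complex.mul_conj', ← Complex.ofReal_pow,
      Complex.re_mul_ofReal]
  have hsum : circleAverage (fun z => z.re * ‖p.eval z‖ ^ 2) 0 1 =
      ∑ k ∈ Finset.range N, PowerSeries.coeff k sqrtSeries * r ^ k *
        (PowerSeries.coeff (k + 1) sqrtSeries * r ^ (k + 1)) := by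
    have hdeg' : (X * p).natDegree < N + 2 := by
      have := natDegree_mul_le (p := X) (q := p)
      rw [natDegree_X] at this
      omega
    simp only [hinner]
    rw [circleAverage_inner_eval p (X * p) (hdeg.trans (Nat.lt_succ_self _)) hdeg',
      Finset.sum_range_succ', mul_coeff_zero, coeff_X_zero, zero_mul, inner_zero_right, add_zero,
      Finset.sum_range_succ, coeff_eq_zero_of_natDegree_lt hdeg, inner_zero_left, add_zero]
    refine Finset.sum_congr rfl fun k hk => ?_
    have hk : k < N := Finset.mem_range.1 hk
    rw [coeff_X_mul, hp, coeff_sqrtPolynomial (Nat.succ_lt_succ hk),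
      coeff_sqrtPolynomial (hk.trans (Nat.lt_succ_self N)), Complex.inner, Complex.conj_ofReal,
      ← Complex.ofReal_mul, Complex.ofReal_re, mul_comm]
  rw [← hsum, abs_sub_comm]
  refine abs_circleAverage_sub_le (by fun_prop) (by fun_prop) fun z hz => ?_
  have hz : ‖z‖ = 1 := by simpa using hz
  rw [← mul_sub, abs_mul]
  exact (mul_le_of_le_one_left (abs_nonneg _) ((Complex.abs_re_le_norm z).trans_eq hz)).trans
    (abs_norm_eval_sqrtPolynomial_sq_sub_le N hr hz)

end SquareRootSeries

section EllipseNumerics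

theorem ellipseSpeed_eq_norm (θ : ℝ) :
    ellipseSpeed θ = 3 / 2 * ‖1 - 4 * (((1 / 12 : ℝ) : ℂ) * circleMap 0 1 (2 * θ))‖ := by
  have hnorm : ‖1 - 4 * (((1 / 12 : ℝ) : ℂ) * circleMap 0 1 (2 * θ))‖ ^ 2 =
      (1 - cos (2 * θ) / 3) ^ 2 + (sin (2 * θ) / 3) ^ 2 := by
    rw [← Complex.normSq_eq_norm_sq, Complex.normSq_apply]
    simp [circleMap, Complex.exp_re, Complex.exp_im]
    ring
  rw [← sq_eq_sq₀ (ellipseSpeed_pos θ).le (by positivity), mul_pow, hnorm, ellipseSpeed_sq]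
  have := sin_sq_add_cos_sq (2 * θ)
  have := sin_sq_add_cos_sq θ
  have := cos_two_mul θ
  linarith

theorem ellipsePerimeter_eq_circleAverage :
    ellipsePerimeter =
      3 * π * circleAverage (fun z => ‖1 - 4 * (((1 / 12 : ℝ) : ℂ) * z)‖) 0 1 := by
  simp only [ellipsePerimeter, ellipseSpeed_eq_norm]
  rw [intervalIntegral.integral_const_mul,
    ← circleAverage_zero_one_eq_integral_two_mul
      (f := fun z => ‖1 - 4 * (((1 / 12 : ℝ) : ℂ) * z)‖) (by fun_prop)]
  ring

theorem integral_cos_mul_ellipseSpeed_eq_circleAverage :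
    ∫ θ in 0..2 * π, cos (2 * θ) * ellipseSpeed θ =
      3 * π * circleAverage (fun z => z.re * ‖1 - 4 * (((1 / 12 : ℝ) : ℂ) * z)‖) 0 1 := by
  have hre : ∀ θ : ℝ, cos (2 * θ) * ellipseSpeed θ = 3 / 2 * ((circleMap 0 1 (2 * θ)).re *
      ‖1 - 4 * (((1 / 12 : ℝ) : ℂ) * circleMap 0 1 (2 * θ))‖) := fun θ => by
    rw [ellipseSpeed_eq_norm, show (circleMap 0 1 (2 * θ)).re = cos (2 * θ) by
      simp [circleMap, Complex.exp_re]]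
    ring
  simp only [hre]
  rw [intervalIntegral.integral_const_mul,
    ← circleAverage_zero_one_eq_integral_two_mul
      (f := fun z => z.re * ‖1 - 4 * (((1 / 12 : ℝ) : ℂ) * z)‖) (by fun_prop)]
  ring

theorem eval_trunc_sqrtSeries_sq_sub_le :
    (PowerSeries.trunc 14 sqrtSeries).eval (1 / 12) ^ 2 - (1 - 4 * (1 / 12)) ≤ 3 / 10 ^ 9 := by
  rw [eval_eq_sum_range' (PowerSeries.natDegree_trunc_lt sqrtSeries 13)]
  norm_num [Finset.sum_range_succ, PowerSeries.coeff_trunc, coeff_zero_sqrtSeries,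
    coeff_succ_sqrtSeries, catalan_eq_centralBinom_div, Nat.centralBinom_eq_two_mul_choose,
    Nat.choose_eq_descFactorial_div_factorial]

theorem abs_sum_coeff_sqrtSeries_sq_sub_le :
    |∑ k ∈ Finset.range 14, (PowerSeries.coeff k sqrtSeries * (1 / 12) ^ k) ^ 2 - 1.02797628346| ≤
      1 / 10 ^ 10 := by
  norm_num [Finset.sum_range_succ, coeff_zero_sqrtSeries,
    coeff_succ_sqrtSeries, catalan_eq_centralBinom_div, Nat.centralBinom_eq_two_mul_choose,
    Nat.choose_eq_descFactorial_div_factorial]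

theorem abs_sum_coeff_mul_coeff_succ_sqrtSeries_sub_le :
    |∑ k ∈ Finset.range 13, PowerSeries.coeff k sqrtSeries * (1 / 12) ^ k *
      (PowerSeries.coeff (k + 1) sqrtSeries * (1 / 12) ^ (k + 1)) + 0.16431852766| ≤
      1 / 10 ^ 10 := by
  norm_num [Finset.sum_range_succ, coeff_zero_sqrtSeries,
    coeff_succ_sqrtSeries, catalan_eq_centralBinom_div, Nat.centralBinom_eq_two_mul_choose,
    Nat.choose_eq_descFactorial_div_factorial]

theorem abs_ellipsePerimeter_sub_le : |ellipsePerimeter - 9.6884482205| ≤ 1 / 10 ^ 7 := by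
  have havg := (abs_circleAverage_norm_one_sub_sub_le 13 (r := 1 / 12) (by norm_num)).trans
    eval_trunc_sqrtSeries_sq_sub_le
  have hsum := abs_sum_coeff_sqrtSeries_sq_sub_le
  rw [ellipsePerimeter_eq_circleAverage]
  set c := circleAverage (fun z => ‖1 - 4 * (((1 / 12 : ℝ) : ℂ) * z)‖) 0 1
  rw [abs_le] at *
  constructor <;> nlinarith [pi_gt_d20, pi_lt_d20]

theorem abs_integral_cos_mul_ellipseSpeed_add_le :
    |(∫ θ in 0..2 * π, cos (2 * θ) * ellipseSpeed θ) + 1.548665638| ≤ 1 / 10 ^ 7 := by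
  have havg := (abs_circleAverage_re_mul_norm_one_sub_sub_le 13 (r := 1 / 12) (by norm_num)).trans
    eval_trunc_sqrtSeries_sq_sub_le
  have hsum := abs_sum_coeff_mul_coeff_succ_sqrtSeries_sub_le
  rw [integral_cos_mul_ellipseSpeed_eq_circleAverage]
  set c := circleAverage (fun z => z.re * ‖1 - 4 * (((1 / 12 : ℝ) : ℂ) * z)‖) 0 1
  rw [abs_le] at *
  constructor <;> nlinarith [pi_gt_d20, pi_lt_d20]

theorem arsinh_sqrt_three :
    arsinh √3 = 2 * (1 / 2 * log ((1 + 1 / √3) / (1 - 1 / √3))) := by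
  have hsq : √3 ^ 2 = 3 := sq_sqrt (by norm_num)
  have hne : √3 - 1 ≠ 0 := sub_ne_zero.2 (lt_sqrt_of_sq_lt (by norm_num)).ne'
  have hfrac : (1 + 1 / √3) / (1 - 1 / √3) = √3 + √(1 + √3 ^ 2) := by
    rw [hsq, show (1 + 3 : ℝ) = 2 ^ 2 by norm_num, sqrt_sq (by norm_num)]
    field_simp
    linarith
  rw [hfrac, arsinh]
  ring

theorem abs_arsinh_sqrt_three_div_sub_le : |arsinh √3 / √3 - 0.7603459963| ≤ 1 / 10 ^ 8 := by
  have hsq : √3 ^ 2 = 3 := sq_sqrt (by norm_num)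
  have hpow : ∀ i : ℕ, 2 / √3 * (1 / √3) ^ (2 * i + 1) = 2 / 3 * (1 / 3) ^ i := fun i => by
    rw [pow_succ, pow_mul, div_pow, hsq]
    field_simp
    rw [hsq]
  have hlt : |1 / √3| < 1 := by
    rw [abs_of_nonneg (by positivity), div_lt_one (by positivity)]
    exact lt_sqrt_of_sq_lt (by norm_num)
  have hseries := mul_le_mul_of_nonneg_left (sum_range_sub_log_div_le hlt 18)
    (by positivity : 0 ≤ 2 / √3)
  rw [← abs_of_nonneg (by positivity : 0 ≤ 2 / √3), ← abs_mul, mul_sub, Finset.mul_sum,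
    abs_of_nonneg (by positivity : 0 ≤ 2 / √3), abs_of_nonneg (by positivity : 0 ≤ 1 / √3)]
    at hseries
  rw [arsinh_sqrt_three, mul_div_right_comm]
  set L := 1 / 2 * log ((1 + 1 / √3) / (1 - 1 / √3))
  simp only [← mul_div_assoc, hpow] at hseries
  simp only [div_pow 1 √3, hsq, Finset.sum_range_succ, Finset.sum_range_zero] at hseries
  norm_num at hseries ⊢
  rw [abs_le] at *
  constructor <;> linarith

theorem abs_integral_abs_fst_ellipseUniform_sub_le :
    |(∫ x, |x 0| ∂ellipseUniform) - 1.1396442169| ≤ 2 / 10 ^ 8 := by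
  have hper := abs_le.1 abs_ellipsePerimeter_sub_le
  have harsinh := abs_le.1 abs_arsinh_sqrt_three_div_sub_le
  rw [integral_abs_fst_ellipseUniform, abs_sub_le_iff, sub_le_iff_le_add, sub_le_comm,
    div_le_iff₀ ellipsePerimeter_pos, le_div_iff₀ ellipsePerimeter_pos]
  constructor <;> linarith

theorem abs_integral_snd_sq_ellipseUniform_sub_le :
    |(∫ x, x 1 ^ 2 ∂ellipseUniform) - 0.57992330675| ≤ 2 / 10 ^ 8 := by
  have hper := abs_le.1 abs_ellipsePerimeter_sub_le
  have hcos := abs_le.1 abs_integral_cos_mul_ellipseSpeed_add_le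
  rw [integral_snd_sq_ellipseUniform]
  set C := ∫ θ in 0..2 * π, cos (2 * θ) * ellipseSpeed θ
  have hle : C / ellipsePerimeter ≤ -0.1598466134 + 2 / 10 ^ 8 := by
    rw [div_le_iff₀ ellipsePerimeter_pos]
    linarith
  have hge : -0.1598466136 - 2 / 10 ^ 8 ≤ C / ellipsePerimeter := by
    rw [le_div_iff₀ ellipsePerimeter_pos]
    linarith
  rw [abs_le]
  constructor <;> linarith

end EllipseNumerics

section Rearrangement

theorem integral_mul_le_integral_mul_of_crossing {a b c : ℝ} (hc : c ∈ Icc a b) {g v w : ℝ → ℝ}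
    (hg : Continuous g) (hv : Continuous v) (hw : Continuous w) (hmono : MonotoneOn g (Icc a b))
    (hleft : ∀ x ∈ Icc a c, v x ≤ w x) (hright : ∀ x ∈ Icc c b, w x ≤ v x)
    (heq : ∫ x in a..b, w x = ∫ x in a..b, v x) :
    ∫ x in a..b, g x * w x ≤ ∫ x in a..b, g x * v x := by
  have hab : a ≤ b := hc.1.trans hc.2
  have hpt : ∀ x ∈ Icc a b, g x * w x - g x * v x ≤ g c * w x - g c * v x := fun x hx => by
    rcases le_total x c with hxc | hcx
    · nlinarith [hmono hx hc hxc, hleft x ⟨hx.1, hxc⟩]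
    · nlinarith [hmono hc hx hcx, hright x ⟨hcx, hx.2⟩]
  have hint : ∀ {f : ℝ → ℝ}, Continuous f → IntervalIntegrable f volume a b := fun hf =>
    hf.intervalIntegrable a b
  have hle := intervalIntegral.integral_mono_on hab
    (hint (by fun_prop)) (hint (by fun_prop)) hpt
  rw [intervalIntegral.integral_sub (hint (by fun_prop)) (hint (by fun_prop)),
    intervalIntegral.integral_sub (hint (by fun_prop)) (hint (by fun_prop)),
    intervalIntegral.integral_const_mul, intervalIntegral.integral_const_mul, heq, sub_self] at hle
  exact sub_nonpos.1 hle

theorem hasDerivAt_max_zero_sq (x : ℝ) :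
    HasDerivAt (fun y : ℝ => max y 0 ^ 2) (2 * max x 0) x := by
  have hne : ∀ y : ℝ, y ≠ 0 → HasDerivAt (fun y : ℝ => max y 0 ^ 2) (2 * max y 0) y := by
    intro y hy
    rcases hy.lt_or_gt with hneg | hpos
    · rw [max_eq_right hneg.le, mul_zero]
      refine (hasDerivAt_const y (0 : ℝ)).congr_of_eventuallyEq ?_
      filter_upwards [eventually_lt_nhds hneg] with z hz
      rw [max_eq_right hz.le, zero_pow two_ne_zero]
    · rw [max_eq_left hpos.le]
      refine HasDerivAt.congr_of_eventuallyEq (by simpa using hasDerivAt_pow 2 y) ?_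
      filter_upwards [eventually_gt_nhds hpos] with z hz
      rw [max_eq_left hz.le]
  rcases eq_or_ne x 0 with rfl | hx
  · exact hasDerivAt_of_hasDerivAt_of_ne hne (by fun_prop) (by fun_prop)
  · exact hne x hx

theorem integral_max_sub_two_mul_cos_mul_sin_le (k : ℝ) :
    ∫ θ in 0..π / 2, max (k - 2 * cos θ) 0 * sin θ ≤ k ^ 2 / 4 := by
  have hderiv : ∀ θ : ℝ, HasDerivAt (fun θ => max (k - 2 * cos θ) 0 ^ 2 / 4)
      (max (k - 2 * cos θ) 0 * sin θ) θ := fun θ => by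
    have hinner : HasDerivAt (fun θ => k - 2 * cos θ) (2 * sin θ) θ := by
      simpa using ((hasDerivAt_cos θ).const_mul 2).const_sub k
    refine (((hasDerivAt_max_zero_sq _).comp θ hinner).div_const 4).congr_deriv ?_
    ring
  rw [intervalIntegral.integral_eq_sub_of_hasDerivAt (fun θ _ => hderiv θ)
    (Continuous.intervalIntegrable (by fun_prop) _ _), cos_pi_div_two, mul_zero, sub_zero]
  have hk : max k 0 ^ 2 ≤ k ^ 2 := by
    rw [sq_le_sq, abs_of_nonneg (le_max_right k 0)]
    exact max_le (le_abs_self k) (abs_nonneg k)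
  linarith [sq_nonneg (max (k - 2 * cos 0) 0)]

theorem exists_mul_sin_crossing_ellipseSpeed {q : ℝ} (hq : 2 ≤ q) :
    ∃ c ∈ Icc 0 (π / 2), (∀ θ ∈ Icc 0 c, q * sin θ ≤ ellipseSpeed θ) ∧
      ∀ θ ∈ Icc c (π / 2), ellipseSpeed θ ≤ q * sin θ := by
  have hsin : ∀ θ ∈ Icc 0 (π / 2), 0 ≤ q * sin θ := fun θ hθ =>
    mul_nonneg (by linarith) (sin_nonneg_of_nonneg_of_le_pi hθ.1 (by linarith [hθ.2, pi_pos]))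
  have hle : ∀ θ ∈ Icc 0 (π / 2), (q * sin θ ≤ ellipseSpeed θ ↔ (q ^ 2 - 3) * sin θ ^ 2 ≤ 1) :=
    fun θ hθ => by
      rw [← sq_le_sq₀ (hsin θ hθ) (ellipseSpeed_pos θ).le, ellipseSpeed_sq]
      constructor <;> intro h <;> linarith
  have hge : ∀ θ ∈ Icc 0 (π / 2), (ellipseSpeed θ ≤ q * sin θ ↔ 1 ≤ (q ^ 2 - 3) * sin θ ^ 2) :=
    fun θ hθ => by
      rw [← sq_le_sq₀ (ellipseSpeed_pos θ).le (hsin θ hθ), ellipseSpeed_sq]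
      constructor <;> intro h <;> linarith
  have hmono : ∀ θ φ : ℝ, 0 ≤ θ → θ ≤ φ → φ ≤ π / 2 →
      (q ^ 2 - 3) * sin θ ^ 2 ≤ (q ^ 2 - 3) * sin φ ^ 2 := fun θ φ hθ hθφ hφ => by
    have hnonneg := sin_nonneg_of_nonneg_of_le_pi hθ (by linarith [pi_pos])
    have hsin_le := sin_le_sin_of_le_of_le_pi_div_two (by linarith [pi_pos]) hφ hθφ
    have : 0 ≤ q ^ 2 - 3 := by nlinarith
    gcongr
  obtain ⟨c, hc, hcross⟩ : (1 : ℝ) ∈ (fun θ => (q ^ 2 - 3) * sin θ ^ 2) '' Icc 0 (π / 2) := by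
    refine intermediate_value_Icc pi_div_two_pos.le (by fun_prop) ⟨?_, ?_⟩
    · simp
    · simp only [sin_pi_div_two]
      nlinarith
  refine ⟨c, hc, fun θ hθ => ?_, fun θ hθ => ?_⟩
  · exact (hle θ ⟨hθ.1, hθ.2.trans hc.2⟩).2 ((hmono θ c hθ.1 hθ.2 hc.2).trans_eq hcross)
  · exact (hge θ ⟨hc.1.trans hθ.1, hθ.2⟩).2 (hcross.symm.trans_le (hmono c θ hc.1 hθ.1 hθ.2))

theorem integral_mul_ellipseSpeed_quarter_le {g : ℝ → ℝ} (hg : Continuous g)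
    (hmono : MonotoneOn g (Icc 0 (π / 2))) :
    ∫ θ in 0..π / 2, g θ * ellipseSpeed θ ≤
      ellipsePerimeter / 4 * ∫ θ in 0..π / 2, g θ * sin θ := by
  have hq : 2 ≤ ellipsePerimeter / 4 := by linarith [abs_le.1 abs_ellipsePerimeter_sub_le]
  obtain ⟨c, hc, hleft, hright⟩ := exists_mul_sin_crossing_ellipseSpeed hq
  rw [← intervalIntegral.integral_const_mul]
  simp only [mul_left_comm (ellipsePerimeter / 4)]
  refine integral_mul_le_integral_mul_of_crossing hc hg (by fun_prop) (by fun_prop) hmono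
    hleft hright ?_
  rw [integral_ellipseSpeed_quarter, intervalIntegral.integral_const_mul, integral_sin, cos_zero,
    cos_pi_div_two, sub_zero, mul_one]

theorem integral_max_abs_fst_ellipseUniform_le (k : ℝ) :
    ∫ x, max |x 0| k ∂ellipseUniform ≤ (∫ x, |x 0| ∂ellipseUniform) + k ^ 2 / 4 := by
  have hmax : ∀ x : Plane, max |x 0| k = |x 0| + max (k - |x 0|) 0 := fun x => by
    rw [← max_add_add_left, add_sub_cancel, add_zero, max_comm]
  simp only [hmax]
  rw [integral_add (integrable_ellipseUniform (by fun_prop))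
    (integrable_ellipseUniform (by fun_prop)),
    integral_comp_abs_fst_ellipseUniform (φ := fun u => max (k - u) 0) (by fun_prop)]
  refine add_le_add_right ?_ _
  have hmono : MonotoneOn (fun θ => max (k - 2 * cos θ) 0) (Icc 0 (π / 2)) :=
    fun θ hθ φ hφ hle => by
      have := cos_le_cos_of_nonneg_of_le_pi hθ.1 (by linarith [hφ.2, pi_pos]) hle
      exact max_le_max (by linarith) le_rfl
  rw [div_le_iff₀ ellipsePerimeter_pos]
  nlinarith [integral_mul_ellipseSpeed_quarter_le (by fun_prop) hmono,
    integral_max_sub_two_mul_cos_mul_sin_le k, ellipsePerimeter_pos]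

end Rearrangement

section EllipseSplits

theorem integrable_id_ellipseUniform : Integrable id ellipseUniform :=
  (memLp_ellipseUniform continuous_id 1).integrable le_rfl

theorem integral_inner_ellipseUniform (d : Plane) : ∫ x, ⟪d, x⟫ ∂ellipseUniform = 0 :=
  isUnconditional_ellipseUniform.integral_inner_eq_zero integrable_id_ellipseUniform d

theorem integral_coord_ellipseUniform (i : Fin 2) : ∫ x, x i ∂ellipseUniform = 0 :=
  isUnconditional_ellipseUniform.integral_eq_zero_of_odd i (negCoord_apply_self i)

theorem integral_affine_sq_ellipseUniform (r t s : ℝ) :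
    ∫ x, (r * x 0 + t * x 1 - s) ^ 2 ∂ellipseUniform =
      r ^ 2 * (∫ x, x 0 ^ 2 ∂ellipseUniform) + t ^ 2 * (∫ x, x 1 ^ 2 ∂ellipseUniform) + s ^ 2 := by
  have hcross : ∫ x, x 0 * x 1 ∂ellipseUniform = 0 :=
    isUnconditional_ellipseUniform.integral_coord_mul_coord zero_ne_one
  have hexpand : ∀ x : Plane, (r * x 0 + t * x 1 - s) ^ 2 = r ^ 2 * x 0 ^ 2 + t ^ 2 * x 1 ^ 2 +
      s ^ 2 + (2 * r * t * (x 0 * x 1) - 2 * r * s * x 0 - 2 * t * s * x 1) := fun x => by ring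
  have hint : ∀ {f : Plane → ℝ}, Continuous f → Integrable f ellipseUniform :=
    integrable_ellipseUniform
  simp only [hexpand]
  repeat rw [integral_add (hint (by fun_prop)) (hint (by fun_prop))]
  repeat rw [integral_sub (hint (by fun_prop)) (hint (by fun_prop))]
  simp [integral_const_mul, integral_coord_ellipseUniform, hcross]

theorem sq_integral_abs_fst_add_mul_snd_sub_ellipseUniform_lt {t s : ℝ} (ht : t ^ 2 ≤ 1)
    (hts : t ≠ 0 ∨ s ≠ 0) :
    (∫ x, |x 0 + t * x 1 - s| ∂ellipseUniform) ^ 2 <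
      (∫ x, |x 0| ∂ellipseUniform) ^ 2 * (1 + t ^ 2) + s ^ 2 := by
  obtain ⟨hlo, hhi⟩ := abs_le.1 abs_integral_abs_fst_ellipseUniform_sub_le
  set a := ∫ x, |x 0| ∂ellipseUniform
  have hq : 0 < t ^ 2 + s ^ 2 := by rcases hts with h | h <;> positivity
  rcases le_total (t ^ 2 + s ^ 2) 6.8 with hsmall | hlarge
  · have hle : ∫ x, |x 0 + t * x 1 - s| ∂ellipseUniform ≤ a + (t ^ 2 + s ^ 2) / 4 := by
      refine isUnconditional_ellipseUniform.integral_abs_affine_le integrable_id_ellipseUniform ?_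
        (fun k _ => integral_max_abs_fst_ellipseUniform_le k) s t
      filter_upwards [ae_ellipseUniform] with x hx
      rw [← sq_le_one_iff_abs_le_one]
      nlinarith [sq_nonneg (x 0)]
    refine (pow_le_pow_left₀ (integral_nonneg fun x => abs_nonneg _) hle 2).trans_lt ?_
    have ha : 1 ≤ a ^ 2 := by nlinarith
    have hfactor : a / 2 + (t ^ 2 + s ^ 2) / 16 < 1 := by linarith
    nlinarith [mul_pos hq (sub_pos.2 hfactor), mul_nonneg (sub_nonneg.2 ha) (sq_nonneg t)]
  · have heq : ∫ x, |x 0 + t * x 1 - s| ∂ellipseUniform = |s| := by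
      refine integral_abs_sub_eq_abs_of_abs_le (integrable_ellipseUniform (by fun_prop)) ?_ ?_
      · rw [integral_add (integrable_ellipseUniform (by fun_prop))
          (integrable_ellipseUniform (by fun_prop)), integral_const_mul,
          integral_coord_ellipseUniform, integral_coord_ellipseUniform, mul_zero, add_zero]
      · filter_upwards [ae_ellipseUniform] with x hx
        rw [← sq_le_sq]
        nlinarith [sq_nonneg (4 * x 1 - t * x 0)]
    rw [heq, sq_abs]
    have : 0 < a := by linarith
    have : 0 < a ^ 2 * (1 + t ^ 2) := by positivity
    linarith

theorem sq_integral_abs_affine_ellipseUniform_lt_of_sq_le {r t : ℝ} (ht : t ≠ 0)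
    (hrt : r ^ 2 ≤ t ^ 2) (s : ℝ) :
    (∫ x, |r * x 0 + t * x 1 - s| ∂ellipseUniform) ^ 2 <
      (∫ x, |x 0| ∂ellipseUniform) ^ 2 * (r ^ 2 + t ^ 2) + s ^ 2 := by
  refine (sq_integral_abs_le_integral_sq (memLp_ellipseUniform (by fun_prop) 2)).trans_lt ?_
  rw [integral_affine_sq_ellipseUniform, integral_fst_sq_ellipseUniform]
  have ha := abs_le.1 abs_integral_abs_fst_ellipseUniform_sub_le
  have hy := abs_le.1 abs_integral_snd_sq_ellipseUniform_sub_le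
  have ha2 : 1.29 ≤ (∫ x, |x 0| ∂ellipseUniform) ^ 2 := by nlinarith
  have ht2 : 0 < t ^ 2 := by positivity
  nlinarith [sq_nonneg r]

theorem sq_integral_abs_affine_ellipseUniform_lt_of_sq_lt {r t s : ℝ} (hrt : t ^ 2 < r ^ 2)
    (hts : t ≠ 0 ∨ s ≠ 0) :
    (∫ x, |r * x 0 + t * x 1 - s| ∂ellipseUniform) ^ 2 <
      (∫ x, |x 0| ∂ellipseUniform) ^ 2 * (r ^ 2 + t ^ 2) + s ^ 2 := by
  have hr2 : 0 < r ^ 2 := (sq_nonneg t).trans_lt hrt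
  have hr : r ≠ 0 := pow_ne_zero_iff two_ne_zero |>.1 hr2.ne'
  have hscale : ∀ x : Plane, |r * x 0 + t * x 1 - s| = |r| * |x 0 + t / r * x 1 - s / r| :=
    fun x => by
      rw [← abs_mul]
      congr 1
      field_simp
  have hlt := sq_integral_abs_fst_add_mul_snd_sub_ellipseUniform_lt (t := t / r) (s := s / r)
    (by rw [div_pow, div_le_one hr2]; exact hrt.le)
    (hts.imp (div_ne_zero · hr) (div_ne_zero · hr))
  simp only [hscale]
  rw [integral_const_mul, mul_pow, sq_abs]
  refine (mul_lt_mul_of_pos_left hlt hr2).trans_eq ?_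
  field_simp

theorem splits_ellipseUniform :
    Splits ellipseUniform (!₂[∫ x, |x 0| ∂ellipseUniform, 0] : Plane) := by
  have ha0 : 0 < ∫ x, |x 0| ∂ellipseUniform := by
    linarith [abs_le.1 abs_integral_abs_fst_ellipseUniform_sub_le]
  set a := ∫ x, |x 0| ∂ellipseUniform with ha
  have hinner : ∀ d x : Plane, ⟪d, x⟫ = d 0 * x 0 + d 1 * x 1 := fun d x => by
    simp [PiLp.inner_apply, Fin.sum_univ_two, mul_comm]
  have hnorm : ∀ d : Plane, ‖d‖ ^ 2 = d 0 ^ 2 + d 1 ^ 2 := fun d => by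
    rw [EuclideanSpace.real_norm_sq_eq, Fin.sum_univ_two]
  have hnorm_a : ‖(!₂[a, 0] : Plane)‖ ^ 2 = a ^ 2 := by simp [hnorm]
  refine ⟨?_, fun d c hd hspan => ?_⟩
  · rw [hnorm_a]
    simp [hinner, abs_mul, abs_of_pos ha0, integral_const_mul, ← ha, sq]
  · rw [hnorm_a, hnorm]
    simp only [hinner]
    rcases le_or_gt (d 0 ^ 2) (d 1 ^ 2) with hle | hlt
    · refine sq_integral_abs_affine_ellipseUniform_lt_of_sq_le (fun h₁ => hd ?_) hle c
      have h₀ : d 0 = 0 := by nlinarith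
      ext i
      fin_cases i
      exacts [h₀, h₁]
    · refine sq_integral_abs_affine_ellipseUniform_lt_of_sq_lt hlt ?_
      by_contra! hzero
      refine hspan hzero.2 (Submodule.mem_span_singleton.2 ⟨d 0 / a, ?_⟩)
      ext i
      fin_cases i <;> simp [ha0.ne', hzero.1]

theorem integral_norm_sq_ellipseUniform :
    ∫ x, ‖x‖ ^ 2 ∂ellipseUniform = 4 - 3 * ∫ x, x 1 ^ 2 ∂ellipseUniform := by
  simp only [EuclideanSpace.real_norm_sq_eq, Fin.sum_univ_two]
  rw [integral_add (integrable_ellipseUniform (by fun_prop))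
    (integrable_ellipseUniform (by fun_prop)), integral_fst_sq_ellipseUniform]
  ring

theorem quantizationError_two_ellipseUniform :
    quantizationError 2 ellipseUniform =
      ENNReal.ofReal (4 - 3 * ∫ x, x 1 ^ 2 ∂ellipseUniform -
        (∫ x, |x 0| ∂ellipseUniform) ^ 2) := by
  rw [splits_ellipseUniform.quantizationError_two (memLp_ellipseUniform continuous_id 2)
    integral_inner_ellipseUniform,
    integral_norm_sq_ellipseUniform, EuclideanSpace.real_norm_sq_eq]
  simp

theorem isOptimalSetOfMeans_two_ellipseUniform_iff (α : Set Plane) :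
    IsOptimalSetOfMeans 2 ellipseUniform α ↔
      α = {!₂[∫ x, |x 0| ∂ellipseUniform, 0], !₂[-∫ x, |x 0| ∂ellipseUniform, 0]} := by
  rw [splits_ellipseUniform.isOptimalSetOfMeans_two_iff (memLp_ellipseUniform continuous_id 2)
    integral_inner_ellipseUniform]
  have hneg : ∀ a : ℝ, -(!₂[a, 0] : Plane) = !₂[-a, 0] := fun a => by
    ext i
    fin_cases i <;> simp
  rw [hneg]

end EllipseSplits

end

theorem mainTheorem10 :
    ∃ a : ℝ, |a - 1.13964| < 0.000005 ∧
      (∀ α : Set Plane, IsOptimalSetOfMeans 2 ellipseUniform α ↔ α = {!₂[a, 0], !₂[-a, 0]}) ∧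
      quantizationError 2 ellipseUniform ≠ ∞ ∧
      |(quantizationError 2 ellipseUniform).toReal - 0.961441| < 0.0000005 := by
  have ha := abs_integral_abs_fst_ellipseUniform_sub_le
  have hy := abs_le.1 abs_integral_snd_sq_ellipseUniform_sub_le
  refine ⟨∫ x, |x 0| ∂ellipseUniform, ?_, isOptimalSetOfMeans_two_ellipseUniform_iff, ?_, ?_⟩
  · exact (abs_sub_le _ 1.1396442169 _).trans_lt (by norm_num; linarith)
  · rw [quantizationError_two_ellipseUniform]
    exact ENNReal.ofReal_ne_top
  · rw [quantizationError_two_ellipseUniform]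
    rw [abs_le] at ha
    rw [ENNReal.toReal_ofReal (by nlinarith), abs_lt]
    constructor <;> nlinarith
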